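/- Let $\nu$ be Lebesgue measure on the circle $\mathbb{R}/\mathbb{Z}$ (so $\nu(\mathbb{R}/\mathbb{Z})=1$), and let $f=\chi_{[0,1/2)}-\chi_{[1/2,1)}:\mathbb{R}/\mathbb{Z}\to\mathbb{Z}$. For irrational $\alpha\in(0,1)$, the infinite staircase in direction $\alpha$ is the skew product $T_\alpha(x,m)=(x+\alpha,\,m+f(x))$ on $\mathbb{R}/\mathbb{Z}\times\mathbb{Z}$, equipped with the product of $\nu$ and counting measure; its Lyapunov exponent is $$\Lambda(\alpha)=\limsup_{n\to\infty}\frac{\log\left(\operatorname{ess\,sup}_{x\in\mathbb{R}/\mathbb{Z}}\left|\sum_{i=0}^{n-1}f(x+i\alpha)\right|\right)}{\log n}.$$ For each $\lambda\in(0,1/2)$ there is an uncountable set of irrational $\alpha\in(0,1)$ such that, for every $\alpha$ in this set, $T_\alpha$ is ergodic (with respect to the product measure) and $\Lambda(\alpha)\geq\lambda$; in particular $\Lambda(\alpha)\neq 0$. -/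

import Mathlib

open MeasureTheory Filter

noncomputable section

namespace Staircase

/-- The skew transformation `T(y, g) = (S y, g + f y)` on `Y × G`. -/
def skewProduct {Y G : Type*} [Add G] (S : Y → Y) (f : Y → G) : Y × G → Y × G :=
  fun p => (S p.1, p.2 + f p.1)

/-- The principal Lyapunov exponent
`limsup_{n → ∞} log (ess sup_y ‖∑_{i < n} f (S^i y)‖) / log n` of the cocycle `f` over `S`,
as an extended real number (with `log 0 = -∞`). -/
def lyapunovExponent {Y G : Type*} [MeasurableSpace Y] [NormedAddCommGroup G]
    (ν : Measure Y) (S : Y → Y) (f : Y → G) : EReal :=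
  limsup (fun n : ℕ =>
    ENNReal.log (essSup (fun y => ‖birkhoffSum S f n y‖ₑ) ν) / ((Real.log n : ℝ) : EReal)) atTop

/-- The rotation `x ↦ x + α` of the circle `ℝ / ℤ`. -/
def rotation (α : ℝ) : UnitAddCircle → UnitAddCircle :=
  fun x => x + (α : UnitAddCircle)

/-- The staircase cocycle `χ_[0,1/2) - χ_[1/2,1)` on the circle `ℝ / ℤ`. -/
def staircaseCocycle : UnitAddCircle → ℤ :=
  Set.indicator ((fun t : ℝ => (t : UnitAddCircle)) '' Set.Ico 0 (1 / 2)) 1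
    - Set.indicator ((fun t : ℝ => (t : UnitAddCircle)) '' Set.Ico (1 / 2) 1) 1

/-- The infinite staircase in direction `α`: the skew product on `ℝ / ℤ × ℤ` of the rotation by
`α` with the staircase cocycle. -/
def infiniteStaircase (α : ℝ) : UnitAddCircle × ℤ → UnitAddCircle × ℤ :=
  skewProduct (rotation α) staircaseCocycle

/-- The Lyapunov exponent of the infinite staircase in direction `α`, with respect to Lebesgue
measure on the circle. -/
def staircaseLyapunovExponent (α : ℝ) : EReal :=
  lyapunovExponent (volume : Measure UnitAddCircle) (rotation α) staircaseCocycle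

end Staircase

end

/-! One Baire-generic set of directions serves every `l`: the irrational α in (0,1) with |α - p/q| <
1/(8q³) for coprime p, q with q odd and arbitrarily large. Along q steps from a point just right of
k/q, the orbit stays just right of fractions and visits each residue class mod q once. As q is odd,
(q+1)/2 of these have value 1 and (q-1)/2 have value -1, so the Birkhoff sum S_q is 1
(`birkhoffSum_rotation_eq_one`).

Exponent: over q² steps the drift is below 1/(8q), so q such blocks add up to S_{q²} = q on an
interval. Since log q / log q² = 1/2, the exponent is at least 1/2.

Ergodicity: let E_m be the slices of an invariant set. Where S_q = 1, y lies in E_m iff y + qα lies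
in E_{m+1}, and qα tends to 0 on the circle. The set {S_q = 1} and its translate by 1/(2q) cover
almost everything, so continuity of translation in measure gives E_m = E_{m+1} a.e.
(`ae_eq_of_birkhoffSum_eq_one`). All slices then agree with one rotation-invariant set, which is
null or conull. -/

namespace Staircase

open Set Topology
open scoped symmDiff

/-! ### Cocycle and rotation on real representatives -/

theorem staircaseCocycle_coe {t : ℝ} (h0 : 0 ≤ t) (h1 : t < 1) :
    staircaseCocycle (t : UnitAddCircle) = if t < 1 / 2 then 1 else -1 := by
  have key : ∀ {a b : ℝ}, 0 ≤ a → b ≤ 1 →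
      ((t : UnitAddCircle) ∈ (fun t : ℝ => (t : UnitAddCircle)) '' Ico a b ↔ t ∈ Ico a b) := by
    intro a b ha hb
    constructor
    · rintro ⟨s, hs, hst⟩
      have h := (AddCircle.coe_eq_coe_iff_of_mem_Ico (p := (1 : ℝ)) (a := 0) (x := s) (y := t)
        ⟨ha.trans hs.1, by linarith [hs.2]⟩ ⟨h0, by linarith⟩).1 hst
      exact h ▸ hs
    · exact fun h => ⟨t, h, rfl⟩
  have hl := key le_rfl (by norm_num : (1 / 2 : ℝ) ≤ 1)
  have hr := key (by norm_num : (0 : ℝ) ≤ 1 / 2) le_rfl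
  rw [staircaseCocycle, Pi.sub_apply]
  rcases lt_or_ge t (1 / 2) with h | h
  · rw [indicator_of_mem (hl.2 ⟨h0, h⟩), indicator_of_notMem fun h' => not_le.2 h (hr.1 h').1,
      if_pos h]
    rfl
  · rw [indicator_of_mem (hr.2 ⟨h, h1⟩), indicator_of_notMem fun h' => not_lt.2 h (hl.1 h').2,
      if_neg (not_lt.2 h)]
    rfl

theorem measurable_staircaseCocycle : Measurable staircaseCocycle := by
  have h : staircaseCocycle = fun y : UnitAddCircle =>
      if ((AddCircle.measurableEquivIco 1 0 y : Ico (0 : ℝ) (0 + 1)) : ℝ) < 1 / 2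
        then (1 : ℤ) else -1 := by
    funext y
    have hy : ((AddCircle.equivIco 1 0 y : Ico (0 : ℝ) (0 + 1)) : ℝ) < 0 + 1 :=
      (AddCircle.equivIco 1 0 y).2.2
    conv_lhs => rw [← AddCircle.coe_equivIco (a := (0 : ℝ)) (y := y)]
    exact staircaseCocycle_coe (AddCircle.equivIco 1 0 y).2.1 (by linarith)
  rw [h]
  refine Measurable.ite ?_ measurable_const measurable_const
  exact measurableSet_lt
    (measurable_subtype_coe.comp (AddCircle.measurableEquivIco 1 0).measurable) measurable_const

theorem rotation_iterate (α : ℝ) (n : ℕ) :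
    (rotation α)^[n] = fun y => y + ((n * α : ℝ) : UnitAddCircle) := by
  induction n with
  | zero => funext y; simp
  | succ n ih =>
    funext y
    rw [Function.iterate_succ_apply', ih]
    simp only [rotation, add_assoc, ← AddCircle.coe_add]
    congr 3
    push_cast
    ring

theorem rotation_iterate_coe (α t : ℝ) (n : ℕ) :
    (rotation α)^[n] (t : UnitAddCircle) = ((t + n * α : ℝ) : UnitAddCircle) := by
  rw [rotation_iterate]
  rfl

theorem coe_add_int (t : ℝ) (z : ℤ) :
    ((t + z : ℝ) : UnitAddCircle) = (t : UnitAddCircle) := by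
  have : ((z : ℝ) : UnitAddCircle) = 0 := (AddCircle.coe_eq_zero_iff 1).2 ⟨z, by simp⟩
  rw [AddCircle.coe_add, this, add_zero]

/-! ### Birkhoff sums near fractions with odd denominator -/

/-- Slightly to the right of a fraction with odd denominator, the cocycle only depends on the
residue class of the numerator. -/
theorem staircaseCocycle_div_add {q : ℕ} (hq : Odd q) (z : ℤ) {w : ℝ} (hw0 : 0 < w)
    (hw1 : w < 1 / (2 * q)) :
    staircaseCocycle ((z / q + w : ℝ) : UnitAddCircle) =
      if 2 * (z : ZMod q).val < q then 1 else -1 := by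
  have hq0 : 0 < q := hq.pos
  have : NeZero q := ⟨hq0.ne'⟩
  have hqR : (0 : ℝ) < q := by exact_mod_cast hq0
  set r := (z : ZMod q).val with hr
  have hrq : r + 1 ≤ q := ZMod.val_lt _
  have hrqR : (r : ℝ) + 1 ≤ q := by exact_mod_cast hrq
  have hz : z = r + q * (z / q) := by
    rw [hr, ZMod.val_intCast, Int.emod_add_mul_ediv]
  have hcoe : ((z / q + w : ℝ) : UnitAddCircle) = ((r / q + w : ℝ) : UnitAddCircle) := by
    rw [← coe_add_int (r / q + w) (z / q)]
    congr 1
    have hzR : (z : ℝ) = r + q * ((z / q : ℤ) : ℝ) := by exact_mod_cast hz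
    rw [hzR]
    field_simp
    ring
  have hwq : 2 * (q * w) < 1 := by
    rw [lt_div_iff₀ (by positivity)] at hw1
    linarith
  have hmul : (r / q + w) * q = r + q * w := by field_simp
  have hwq0 : 0 < q * w := by positivity
  rw [hcoe, staircaseCocycle_coe (by positivity)]
  · congr 1
    rw [eq_iff_iff, ← mul_lt_mul_iff_left₀ hqR, hmul]
    constructor
    · intro h
      have : (2 * r : ℝ) < q := by linarith
      exact_mod_cast this
    · intro h
      -- Integrality improves 2r < q to 2r + 1 ≤ q, which leaves room for 2qw < 1.
      have : (2 * r + 1 : ℝ) ≤ q := by exact_mod_cast h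
      linarith
  · rw [← mul_lt_mul_iff_left₀ hqR, hmul]
    linarith

theorem sum_range_sign (h : ℕ) :
    ∑ r ∈ Finset.range (2 * h + 1), (if 2 * r < 2 * h + 1 then (1 : ℤ) else -1) = 1 := by
  have h1 : 2 * h + 1 = (h + 1) + h := by ring
  have e1 : ∀ r ∈ Finset.range (h + 1), (if 2 * r < 2 * h + 1 then (1 : ℤ) else -1) = 1 := by
    intro r hr
    rw [Finset.mem_range] at hr
    rw [if_pos (by omega)]
  have e2 : ∀ r ∈ Finset.range h, (if 2 * (h + 1 + r) < 2 * h + 1 then (1 : ℤ) else -1) = -1 := by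
    intro r _
    rw [if_neg (by omega)]
  conv_lhs => rw [show Finset.range (2 * h + 1) = Finset.range ((h + 1) + h) by rw [h1]]
  rw [Finset.sum_range_add, Finset.sum_congr rfl e1, Finset.sum_congr rfl e2]
  simp

theorem sum_zmod_sign {q : ℕ} [NeZero q] (hq : Odd q) :
    ∑ r : ZMod q, (if 2 * r.val < q then (1 : ℤ) else -1) = 1 := by
  obtain ⟨h, rfl⟩ := hq
  refine Eq.trans ?_ (sum_range_sign h)
  refine Finset.sum_bij' (fun r _ => r.val) (fun i _ => (i : ZMod (2 * h + 1))) ?_ ?_ ?_ ?_ ?_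
  · intro r _; exact Finset.mem_range.2 (ZMod.val_lt r)
  · intros; exact Finset.mem_univ _
  · intro r _; simp
  · intro i hi; exact ZMod.val_cast_of_lt (Finset.mem_range.1 hi)
  · intros; rfl

/-- As p is invertible mod q, i ↦ k + ip runs through every residue exactly once; its inverse is r ↦
(r - k)a, with a the Bézout inverse of p. -/
theorem sum_range_sign_affine {q : ℕ} (hq : Odd q) {p : ℤ} (hp : IsCoprime p (q : ℤ)) (k : ℤ) :
    ∑ i ∈ Finset.range q, (if 2 * ((k + i * p : ℤ) : ZMod q).val < q then (1 : ℤ) else -1) = 1 := by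
  have : NeZero q := ⟨hq.pos.ne'⟩
  obtain ⟨a, b, hab⟩ := hp
  have hpa : (a : ZMod q) * p = 1 := by
    have := congrArg (fun n : ℤ => (n : ZMod q)) hab
    simpa using this
  refine Eq.trans ?_ (sum_zmod_sign hq)
  refine Finset.sum_bij' (fun i _ => ((k + i * p : ℤ) : ZMod q))
    (fun r _ => ((r - k) * a : ZMod q).val) ?_ ?_ ?_ ?_ ?_
  · intros; exact Finset.mem_univ _
  · intro r _; exact Finset.mem_range.2 (ZMod.val_lt _)
  · intro i hi
    have : (((k + i * p : ℤ) : ZMod q) - k) * a = (i : ZMod q) := by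
      push_cast
      linear_combination (i : ZMod q) * hpa
    simp only [this]
    exact ZMod.val_cast_of_lt (Finset.mem_range.1 hi)
  · intro r _
    push_cast
    rw [ZMod.natCast_zmod_val]
    linear_combination (r - k) * hpa
  · intros; rfl

/-- The i-th orbit point is (k + ip)/q + u + i(α - p/q). The bounds on u keep the offset inside (0,
1/(2q)) for all i < q, so only residues matter. -/
theorem birkhoffSum_rotation_eq_one {α : ℝ} {q : ℕ} (hq : Odd q) {p : ℤ}
    (hp : IsCoprime p (q : ℤ)) (k : ℤ) {u : ℝ} (hu0 : q * |α - p / q| < u)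
    (hu1 : u + q * |α - p / q| < 1 / (2 * q)) :
    birkhoffSum (rotation α) staircaseCocycle q ((k / q + u : ℝ) : UnitAddCircle) = 1 := by
  have hqR : (0 : ℝ) < q := by exact_mod_cast hq.pos
  rw [birkhoffSum, ← sum_range_sign_affine hq hp k]
  refine Finset.sum_congr rfl fun i hi => ?_
  have hi' : (i : ℝ) ≤ q := by exact_mod_cast (Finset.mem_range.1 hi).le
  have hb : |i * (α - p / q)| ≤ q * |α - p / q| := by
    rw [abs_mul, Nat.abs_cast]
    gcongr
  have hb' := abs_le.1 hb
  rw [rotation_iterate_coe, ← staircaseCocycle_div_add hq (k + i * p) (w := u + i * (α - p / q))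
    (by linarith) (by linarith)]
  congr 2
  push_cast
  field_simp
  ring

/-- A block of q steps contributes 1, replaces k by k + qp and shifts u by q(α - p/q); the margin m
· q|α - p/q| pays for m such shifts. -/
theorem birkhoffSum_rotation_mul {α : ℝ} {q : ℕ} (hq : Odd q) {p : ℤ}
    (hp : IsCoprime p (q : ℤ)) (m : ℕ) (k : ℤ) {u : ℝ} (hu0 : m * (q * |α - p / q|) < u)
    (hu1 : u + m * (q * |α - p / q|) < 1 / (2 * q)) :
    birkhoffSum (rotation α) staircaseCocycle (m * q) ((k / q + u : ℝ) : UnitAddCircle) = m := by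
  have hqR : (0 : ℝ) < q := by exact_mod_cast hq.pos
  induction m generalizing k u with
  | zero => simp
  | succ m ih =>
    push_cast at hu0 hu1
    have h0 : 0 ≤ q * |α - p / q| := by positivity
    have hm0 : 0 ≤ m * (q * |α - p / q|) := by positivity
    have hb := abs_le.1 (abs_mul (q : ℝ) (α - p / q)).le
    rw [Nat.abs_cast] at hb
    have hpt : (k / q + u + q * α : ℝ) =
        ((k + q * p : ℤ) : ℝ) / q + (u + q * (α - p / q)) := by
      push_cast
      field_simp
      ring
    rw [show (m + 1) * q = q + m * q by ring, birkhoffSum_add,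
      birkhoffSum_rotation_eq_one hq hp k (by linarith) (by linarith), rotation_iterate_coe, hpt,
      ih (k + q * p) (by linarith) (by linarith)]
    push_cast
    ring

/-! ### Lower bound for the exponent -/

/-- The rational number `p / q` has odd denominator and approximates `α` up to `1 / (8 q ^ 3)`. -/
def IsCubicOddApprox (α : ℝ) (p : ℤ) (q : ℕ) : Prop :=
  Odd q ∧ IsCoprime p (q : ℤ) ∧ |α - p / q| < 1 / (8 * (q : ℝ) ^ 3)

theorem norm_coe_le (x : ℝ) : ‖(x : UnitAddCircle)‖ ≤ |x| :=
  QuotientAddGroup.norm_mk_le_norm (S := AddSubgroup.zmultiples (1 : ℝ)) (m := x)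

theorem le_essSup_birkhoffSum {α : ℝ} {p : ℤ} {q : ℕ} (h : IsCubicOddApprox α p q) :
    (q : ENNReal) ≤ essSup
      (fun y => ‖birkhoffSum (rotation α) staircaseCocycle (q * q) y‖ₑ) volume := by
  obtain ⟨hq, hp, hα⟩ := h
  have hqR : (0 : ℝ) < q := by exact_mod_cast hq.pos
  -- The interval (0, 1/(2q)) with 1/(8q) trimmed at both ends, the margin that exceeds the drift
  -- over q² steps.
  set U : Set UnitAddCircle :=
    (fun t : ℝ => (t : UnitAddCircle)) '' Ioo (1 / (8 * q)) (3 / (8 * q)) with hU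
  have hUo : IsOpen U := QuotientAddGroup.isOpenMap_coe _ isOpen_Ioo
  have hUne : U ≠ ∅ := by
    refine (Set.Nonempty.image _ (nonempty_Ioo.2 ?_)).ne_empty
    gcongr
    norm_num
  have hval : ∀ y ∈ U, ‖birkhoffSum (rotation α) staircaseCocycle (q * q) y‖ₑ = q := by
    rintro _ ⟨u, hu, rfl⟩
    have hδ : q * (q * |α - p / q|) < 1 / (8 * q) := by
      calc q * (q * |α - p / q|) < q * (q * (1 / (8 * (q : ℝ) ^ 3))) := by gcongr
        _ = 1 / (8 * q) := by field_simp
    have h4 : (1 : ℝ) / (2 * q) = 1 / (8 * q) + 3 / (8 * q) := by field_simp; norm_num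
    have := birkhoffSum_rotation_mul hq hp q 0 (u := u) (hδ.trans hu.1) (by linarith [hu.2])
    simp only [Int.cast_zero, zero_div, zero_add] at this
    rw [this, enorm_eq_nnnorm]
    simp
  by_contra! hlt
  apply hUne
  rw [← hUo.measure_eq_zero_iff volume]
  refine measure_mono_null (fun y hy => ?_)
    (ae_iff.1 (ENNReal.ae_le_essSup
      (fun y => ‖birkhoffSum (rotation α) staircaseCocycle (q * q) y‖ₑ)))
  rw [mem_ofPred_eq, not_le, hval y hy]
  exact hlt

theorem half_le_staircaseLyapunovExponent {α : ℝ}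
    (h : ∀ N : ℕ, ∃ q ≥ N, ∃ p, IsCubicOddApprox α p q) :
    ((1 / 2 : ℝ) : EReal) ≤ staircaseLyapunovExponent α := by
  refine le_limsup_of_frequently_le' (frequently_atTop.2 fun N => ?_)
  -- Asking for N + 2 forces q > 1, hence log q > 0.
  obtain ⟨q, hqN, p, hq⟩ := h (N + 2)
  refine ⟨q * q, by nlinarith, ?_⟩
  have hq1 : (1 : ℝ) < q := by exact_mod_cast (by omega : 1 < q)
  have hlog : 0 < Real.log q := Real.log_pos hq1
  have hlog2 : Real.log ((q * q : ℕ) : ℝ) = 2 * Real.log q := by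
    push_cast
    rw [Real.log_mul (by positivity) (by positivity)]
    ring
  rw [hlog2, EReal.le_div_iff_mul_le (by exact_mod_cast (by positivity : 0 < 2 * Real.log q))
    (EReal.coe_ne_top _), ← EReal.coe_mul, show 1 / 2 * (2 * Real.log q) = Real.log q by ring]
  rw [← ENNReal.log_ofReal_of_pos (by positivity), ENNReal.ofReal_natCast]
  exact ENNReal.log_monotone (le_essSup_birkhoffSum hq)

/-! ### Comparing sets along times with Birkhoff sum 1 -/

theorem tendsto_volume_symmDiff_add {F : Set UnitAddCircle} (hF : MeasurableSet F) :
    Tendsto (fun t : UnitAddCircle => volume (((fun y => y + t) ⁻¹' F) ∆ F)) (𝓝 0) (𝓝 0) := by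
  have hc : Continuous fun t : UnitAddCircle =>
      (⟨fun y => y + t, continuous_add_const t⟩ : C(UnitAddCircle, UnitAddCircle)) :=
    ContinuousMap.continuous_of_continuous_uncurry _ (continuous_snd.add continuous_fst)
  have h := tendsto_measure_symmDiff_preimage_nhds_zero (μ := (volume : Measure UnitAddCircle))
    (ν := volume) (s := F) (hc.tendsto 0)
    (Eventually.of_forall fun t => measurePreserving_add_right volume t)
    (measurePreserving_add_right volume 0) hF.nullMeasurableSet (measure_ne_top _ _)
  simpa using h

theorem measurable_birkhoffSum (α : ℝ) (n : ℕ) :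
    Measurable (birkhoffSum (rotation α) staircaseCocycle n) := by
  unfold birkhoffSum
  refine Finset.measurable_sum _ fun i _ => measurable_staircaseCocycle.comp ?_
  rw [rotation_iterate]
  exact measurable_add_const _

/-- The set where the `q`-th Birkhoff sum is `1`, together with its translate by `1 / (2 q)`,
covers the circle up to small measure. -/
theorem volume_birkhoffSum_ne_one_le {α : ℝ} {p : ℤ} {q : ℕ} (h : IsCubicOddApprox α p q) :
    volume {y : UnitAddCircle | birkhoffSum (rotation α) staircaseCocycle q y ≠ 1 ∧
      birkhoffSum (rotation α) staircaseCocycle q (y - ((1 / (2 * q) : ℝ) : UnitAddCircle)) ≠ 1} ≤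
      ENNReal.ofReal (1 / q) := by
  obtain ⟨hq, hp, hα⟩ := h
  have hqR : (0 : ℝ) < q := by exact_mod_cast hq.pos
  have hq1 : (1 : ℝ) ≤ q := by exact_mod_cast hq.pos
  -- A bound for the drift over q steps. Only points within η of some j/(2q) are lost. On the circle
  -- j = 2q repeats j = 0, which avoids a wraparound case.
  set η : ℝ := 1 / (8 * (q : ℝ) ^ 2) with hη
  have hδ : q * |α - p / q| < η := by
    calc q * |α - p / q| < q * (1 / (8 * (q : ℝ) ^ 3)) := by gcongr
      _ = η := by rw [hη]; field_simp
  have hsub : {y : UnitAddCircle | birkhoffSum (rotation α) staircaseCocycle q y ≠ 1 ∧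
      birkhoffSum (rotation α) staircaseCocycle q (y - ((1 / (2 * q) : ℝ) : UnitAddCircle)) ≠ 1} ⊆
      ⋃ j ∈ Finset.range (2 * q + 1),
        Metric.closedBall (((j : ℝ) / (2 * q) : ℝ) : UnitAddCircle) η := by
    rintro y ⟨hy1, hy2⟩
    set t : ℝ := ((AddCircle.equivIco 1 0 y : Ico (0 : ℝ) (0 + 1)) : ℝ)
    have hty : (t : UnitAddCircle) = y := AddCircle.coe_equivIco
    have ht0 : 0 ≤ t := (AddCircle.equivIco 1 0 y).2.1
    have ht1 : t < 0 + 1 := (AddCircle.equivIco 1 0 y).2.2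
    rw [← hty] at hy1 hy2 ⊢
    rw [← AddCircle.coe_sub] at hy2
    set j := ⌊t * (2 * q)⌋₊ with hj
    have hj0 : (j : ℝ) ≤ t * (2 * q) := Nat.floor_le (by positivity)
    have hj1 : t * (2 * q) < j + 1 := Nat.lt_floor_add_one _
    have hjq : j < 2 * q := by
      have : (j : ℝ) < 2 * q := hj0.trans_lt (by nlinarith)
      exact_mod_cast this
    have hv0 : (j : ℝ) / (2 * q) ≤ t := (div_le_iff₀ (by positivity)).2 hj0
    have hv1 : t < ((j + 1 : ℕ) : ℝ) / (2 * q) :=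
      (lt_div_iff₀ (by positivity)).2 (by push_cast; exact hj1)
    have hball : ∀ i : ℕ, i < 2 * q + 1 → |t - (i : ℝ) / (2 * q)| ≤ η →
        (t : UnitAddCircle) ∈ ⋃ j ∈ Finset.range (2 * q + 1),
          Metric.closedBall (((j : ℝ) / (2 * q) : ℝ) : UnitAddCircle) η := by
      intro i hi hle
      refine mem_biUnion (Finset.mem_coe.2 (Finset.mem_range.2 hi)) ?_
      rw [Metric.mem_closedBall, dist_eq_norm, ← AddCircle.coe_sub]
      exact (norm_coe_le _).trans hle
    have hsucc : ((j + 1 : ℕ) : ℝ) / (2 * q) = (j : ℝ) / (2 * q) + 1 / (2 * q) := by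
      push_cast
      ring
    by_cases hA : t - (j : ℝ) / (2 * q) ≤ η
    · exact hball j (by omega) (by rw [abs_of_nonneg (by linarith)]; exact hA)
    by_cases hB : ((j + 1 : ℕ) : ℝ) / (2 * q) - t ≤ η
    · refine hball (j + 1) (by omega) ?_
      rw [abs_sub_comm, abs_of_nonneg (by linarith)]
      exact hB
    exfalso
    push Not at hA hB
    -- For j = 2k the point itself lies just right of k/q; for j = 2k + 1 its translate by -1/(2q)
    -- does.
    rcases Nat.even_or_odd' j with ⟨k, hk | hk⟩
    · have hkj : (j : ℝ) / (2 * q) = ((k : ℤ) : ℝ) / q := by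
        rw [hk]
        push_cast
        field_simp
      apply hy1
      have := birkhoffSum_rotation_eq_one hq hp k (u := t - (j : ℝ) / (2 * q)) (by linarith)
        (by linarith)
      rwa [← hkj, add_sub_cancel] at this
    · have hkj : (j : ℝ) / (2 * q) = ((k : ℤ) : ℝ) / q + 1 / (2 * q) := by
        rw [hk]
        push_cast
        field_simp
      apply hy2
      have := birkhoffSum_rotation_eq_one hq hp k (u := t - (j : ℝ) / (2 * q)) (by linarith)
        (by linarith)
      rwa [show ((k : ℤ) : ℝ) / q + (t - (j : ℝ) / (2 * q)) = t - 1 / (2 * q) by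
        rw [hkj]; ring] at this
  calc _ ≤ _ := measure_mono hsub
    _ ≤ _ := measure_biUnion_finset_le _ _
    _ ≤ ∑ j ∈ Finset.range (2 * q + 1), ENNReal.ofReal (2 * η) := by
      refine Finset.sum_le_sum fun j _ => ?_
      rw [AddCircle.volume_closedBall]
      exact ENNReal.ofReal_le_ofReal (min_le_right _ _)
    _ = ENNReal.ofReal ((2 * q + 1 : ℕ) * (2 * η)) := by
      rw [Finset.sum_const, Finset.card_range, nsmul_eq_mul,
        ENNReal.ofReal_mul (p := ((2 * q + 1 : ℕ) : ℝ)) (by positivity), ENNReal.ofReal_natCast]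
    _ ≤ ENNReal.ofReal (1 / q) := by
      refine ENNReal.ofReal_le_ofReal ?_
      have : ((2 * q + 1 : ℕ) : ℝ) ≤ 4 * q := by
        push_cast
        linarith
      calc ((2 * q + 1 : ℕ) : ℝ) * (2 * η) ≤ 4 * q * (2 * η) := by gcongr
        _ = 1 / q := by rw [hη]; field_simp; norm_num

/-- On B = {S_q = 1}, a point of E ∆ F lies in the symmetric difference of F and its translate by
qα, which is small. Points outside B are mostly brought into B by a shift of 1/(2q), which barely
changes E ∆ F. -/
theorem ae_eq_of_birkhoffSum_eq_one {α : ℝ}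
    (h : ∀ N : ℕ, ∃ q ≥ N, ∃ p, IsCubicOddApprox α p q) {E F : Set UnitAddCircle}
    (hE : MeasurableSet E) (hF : MeasurableSet F)
    (hEF : ∀ n y, birkhoffSum (rotation α) staircaseCocycle n y = 1 →
      (y ∈ E ↔ y + ((n * α : ℝ) : UnitAddCircle) ∈ F)) :
    E =ᵐ[volume] F := by
  choose q hqN p hq using fun N => h (N + 1)
  set A : Set UnitAddCircle := E ∆ F with hA
  have hAm : MeasurableSet A := hE.symmDiff hF
  have hqinf : Tendsto q atTop atTop :=
    tendsto_atTop_mono (fun N => (Nat.le_succ N).trans (hqN N)) tendsto_id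
  have hqR : Tendsto (fun N => (q N : ℝ)) atTop atTop := tendsto_natCast_atTop_atTop.comp hqinf
  have hq0 : ∀ N, (0 : ℝ) < q N := fun N => by exact_mod_cast (hq N).1.pos
  have hinv : Tendsto (fun N => 1 / (q N : ℝ)) atTop (𝓝 0) := by
    simp only [one_div]
    exact hqR.inv_tendsto_atTop
  have hto : ∀ x : ℕ → ℝ, (∀ N, |x N| ≤ 1 / (q N : ℝ)) →
      Tendsto (fun N => (x N : UnitAddCircle)) atTop (𝓝 0) := fun x hx =>
    squeeze_zero_norm (fun N => (norm_coe_le _).trans (hx N)) hinv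
  have hstep : Tendsto (fun N => ((q N * α : ℝ) : UnitAddCircle)) atTop (𝓝 0) := by
    have heq : ∀ N, ((q N * α : ℝ) : UnitAddCircle) =
        ((q N * (α - p N / q N) : ℝ) : UnitAddCircle) := by
      intro N
      rw [← coe_add_int (q N * (α - p N / q N)) (p N)]
      congr 1
      have := (hq0 N).ne'
      field_simp
      ring
    simp_rw [heq]
    refine hto _ fun N => ?_
    rw [abs_mul, abs_of_pos (hq0 N)]
    have h1 : (1 : ℝ) ≤ q N := by exact_mod_cast (hq N).1.pos
    calc q N * |α - p N / q N| ≤ q N * (1 / (8 * (q N : ℝ) ^ 3)) := by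
          gcongr
          exact (hq N).2.2.le
      _ = 1 / (8 * (q N : ℝ) ^ 2) := by
          have := (hq0 N).ne'
          field_simp
      _ ≤ 1 / q N := by
          gcongr
          nlinarith
  have hhalf : Tendsto (fun N => ((1 / (2 * q N) : ℝ) : UnitAddCircle)) atTop (𝓝 0) := by
    refine hto _ fun N => ?_
    have := hq0 N
    rw [abs_of_pos (by positivity)]
    gcongr
    linarith
  -- With τ = 1/(2q), the terms bound A outside B ∪ (B + τ), then A ∩ B, then A ∩ (B + τ), the last
  -- by translating back into B.
  have hbound : ∀ N, volume A ≤ ENNReal.ofReal (1 / q N) +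
      (volume (((fun y => y + ((q N * α : ℝ) : UnitAddCircle)) ⁻¹' F) ∆ F) +
      (volume (((fun y => y + ((1 / (2 * q N) : ℝ) : UnitAddCircle)) ⁻¹' A) ∆ A) +
        volume (((fun y => y + ((q N * α : ℝ) : UnitAddCircle)) ⁻¹' F) ∆ F))) := by
    intro N
    set τ : UnitAddCircle := ((1 / (2 * q N) : ℝ) : UnitAddCircle)
    set B : Set UnitAddCircle := {y | birkhoffSum (rotation α) staircaseCocycle (q N) y = 1}
    have hB : MeasurableSet B := measurable_birkhoffSum α (q N) (measurableSet_singleton 1)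
    have hAB : volume (A ∩ B) ≤
        volume (((fun y => y + ((q N * α : ℝ) : UnitAddCircle)) ⁻¹' F) ∆ F) := by
      refine measure_mono fun y hy => ?_
      have hy' := hEF _ _ hy.2
      rcases hy.1 with ⟨h1, h2⟩ | ⟨h1, h2⟩
      · exact Or.inl ⟨hy'.1 h1, h2⟩
      · exact Or.inr ⟨h1, fun h3 => h2 (hy'.2 h3)⟩
    have hAB' : volume (A ∩ (fun y => y - τ) ⁻¹' B) ≤
        volume (((fun y => y + τ) ⁻¹' A) ∆ A) + volume (A ∩ B) := by
      have hm : MeasurableSet (A ∩ (fun y => y - τ) ⁻¹' B) :=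
        hAm.inter (measurable_sub_const τ hB)
      rw [← (measurePreserving_add_right volume τ).measure_preimage hm.nullMeasurableSet]
      refine (measure_mono fun y hy => ?_).trans (measure_union_le _ _)
      have hyB : y ∈ B := by simpa using hy.2
      by_cases hyA : y ∈ A
      · exact Or.inr ⟨hyA, hyB⟩
      · exact Or.inl (Or.inl ⟨hy.1, hyA⟩)
    refine (measure_mono (t := {y : UnitAddCircle |
      birkhoffSum (rotation α) staircaseCocycle (q N) y ≠ 1 ∧
      birkhoffSum (rotation α) staircaseCocycle (q N) (y - τ) ≠ 1} ∪
      (A ∩ B ∪ A ∩ (fun y => y - τ) ⁻¹' B)) fun y hy => ?_).trans ?_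
    · by_cases h1 : y ∈ B
      · exact Or.inr (Or.inl ⟨hy, h1⟩)
      by_cases h2 : y - τ ∈ B
      · exact Or.inr (Or.inr ⟨hy, h2⟩)
      · exact Or.inl ⟨h1, h2⟩
    · refine (measure_union_le _ _).trans (add_le_add (volume_birkhoffSum_ne_one_le (hq N)) ?_)
      refine (measure_union_le _ _).trans (add_le_add hAB (hAB'.trans ?_))
      gcongr
  have hlim := (ENNReal.tendsto_ofReal hinv).add
    (((tendsto_volume_symmDiff_add hF).comp hstep).add
      (((tendsto_volume_symmDiff_add hAm).comp hhalf).add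
        ((tendsto_volume_symmDiff_add hF).comp hstep)))
  simp only [ENNReal.ofReal_zero, add_zero] at hlim
  exact measure_symmDiff_eq_zero_iff.1 (le_antisymm (ge_of_tendsto' hlim hbound) zero_le)

/-! ### Ergodicity of the skew product -/

theorem measurePreserving_rotation (α : ℝ) :
    MeasurePreserving (rotation α) (volume : Measure UnitAddCircle) volume :=
  measurePreserving_add_right volume _

theorem measurePreserving_infiniteStaircase (α : ℝ) :
    MeasurePreserving (infiniteStaircase α)
      ((volume : Measure UnitAddCircle).prod (Measure.count : Measure ℤ))
      ((volume : Measure UnitAddCircle).prod (Measure.count : Measure ℤ)) :=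
  (measurePreserving_rotation α).skew_product (g := fun y m => m + staircaseCocycle y)
    (measurable_snd.add (measurable_staircaseCocycle.comp measurable_fst))
    (ae_of_all _ fun y => (measurePreserving_add_right Measure.count (staircaseCocycle y)).map_eq)

theorem infiniteStaircase_iterate (α : ℝ) (n : ℕ) (y : UnitAddCircle) (m : ℤ) :
    (infiniteStaircase α)^[n] (y, m) =
      ((rotation α)^[n] y, m + birkhoffSum (rotation α) staircaseCocycle n y) := by
  induction n with
  | zero => simp
  | succ n ih =>
    rw [Function.iterate_succ_apply', Function.iterate_succ_apply', ih, birkhoffSum_succ,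
      ← add_assoc]
    rfl

theorem ergodic_rotation {α : ℝ} (hα : Irrational α) :
    Ergodic (rotation α) (volume : Measure UnitAddCircle) := by
  refine AddCircle.ergodic_add_right.2 (addOrderOf_eq_zero_iff.2 fun hfin => ?_)
  obtain ⟨n, hn, h⟩ := isOfFinAddOrder_iff_nsmul_eq_zero.1 hfin
  rw [← AddCircle.coe_nsmul, AddCircle.coe_eq_zero_iff] at h
  obtain ⟨z, hz⟩ := h
  rw [zsmul_one, nsmul_eq_mul] at hz
  exact (hα.natCast_mul hn.ne').ne_int z hz.symm

theorem prod_count_eq_zero {s : Set (UnitAddCircle × ℤ)} (hs : MeasurableSet s)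
    (h : ∀ m : ℤ, ∀ᵐ y : UnitAddCircle, (y, m) ∉ s) :
    ((volume : Measure UnitAddCircle).prod (Measure.count : Measure ℤ)) s = 0 := by
  rw [Measure.measure_prod_null hs]
  filter_upwards [ae_all_iff.2 h] with y hy
  exact Measure.count_eq_zero_iff.2 (eq_empty_of_forall_notMem hy)

theorem ergodic_infiniteStaircase {α : ℝ} (hα : Irrational α)
    (h : ∀ N : ℕ, ∃ q ≥ N, ∃ p, IsCubicOddApprox α p q) :
    Ergodic (infiniteStaircase α)
      ((volume : Measure UnitAddCircle).prod (Measure.count : Measure ℤ)) := by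
  refine ⟨measurePreserving_infiniteStaircase α, ⟨fun s hs hinv => ?_⟩⟩
  rw [eventuallyConst_set']
  set E : ℤ → Set UnitAddCircle := fun m => (fun y => (y, m)) ⁻¹' s with hE
  have hEm : ∀ m, MeasurableSet (E m) := fun m => measurable_prodMk_right hs
  have hiter : ∀ n y m, y ∈ E m ↔ (rotation α)^[n] y ∈
      E (m + birkhoffSum (rotation α) staircaseCocycle n y) := by
    intro n y m
    have hn : (infiniteStaircase α)^[n] ⁻¹' s = s := by
      rw [Set.preimage_iterate_eq]
      exact Function.iterate_fixed hinv n
    change (y, m) ∈ s ↔ (_, _) ∈ s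
    rw [← infiniteStaircase_iterate]
    exact (Set.ext_iff.1 hn (y, m)).symm
  have hsucc : ∀ m, E m =ᵐ[volume] E (m + 1) := by
    intro m
    refine ae_eq_of_birkhoffSum_eq_one h (hEm m) (hEm (m + 1)) fun n y hy => ?_
    rw [hiter n y m, hy, rotation_iterate]
  have hall : ∀ m, E m =ᵐ[volume] E 0 := by
    intro m
    induction m using Int.induction_on with
    | zero => exact EventuallyEq.rfl
    | succ n ih => exact (hsucc n).symm.trans ih
    | pred n ih =>
      have := hsucc (-(n : ℤ) - 1)
      rw [sub_add_cancel] at this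
      exact this.trans ih
  have hall' : ∀ᵐ y : UnitAddCircle, ∀ m, y ∈ E m ↔ y ∈ E 0 :=
    ae_all_iff.2 fun m => (hall m).mem_iff
  -- Invariance sends slice 0 to a slice depending on the point, but almost every point has the same
  -- membership in all slices.
  have hrot : rotation α ⁻¹' E 0 =ᵐ[volume] E 0 := by
    filter_upwards [(measurePreserving_rotation α).quasiMeasurePreserving.ae hall'] with y hy
    apply propext
    change rotation α y ∈ E 0 ↔ y ∈ E 0
    rw [hiter 1 y 0, Function.iterate_one, hy, hy (0 + _)]
  rcases (ergodic_rotation hα).quasiErgodic.ae_empty_or_univ₀ (hEm 0).nullMeasurableSet hrot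
    with h0 | h0
  · left
    refine ae_eq_empty.2 (prod_count_eq_zero hs fun m => ?_)
    filter_upwards [((hall m).trans h0).mem_iff] with y hy
    exact fun hys => hy.1 hys
  · right
    refine ae_eq_univ.2 (prod_count_eq_zero hs.compl fun m => ?_)
    filter_upwards [((hall m).trans h0).mem_iff] with y hy
    exact fun hys => hys (hy.2 trivial)

/-! ### Genericity and uncountability -/

theorem exists_coprime_three_pow_near (x : ℝ) (n : ℕ) :
    ∃ p : ℤ, IsCoprime p ((3 ^ (n + 1) : ℕ) : ℤ) ∧
      |x - p / ((3 ^ (n + 1) : ℕ) : ℝ)| ≤ 1 / 3 ^ n := by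
  -- A numerator that is 1 mod 3 is coprime to every power of 3.
  refine ⟨3 * ⌊3 ^ n * x⌋ + 1, ?_, ?_⟩
  · push_cast
    exact IsCoprime.pow_right ⟨1, -⌊3 ^ n * x⌋, by ring⟩
  · have h1 := Int.floor_le (3 ^ n * x)
    have h2 := Int.lt_floor_add_one (3 ^ n * x)
    have h3 : x - ((3 * ⌊3 ^ n * x⌋ + 1 : ℤ) : ℝ) / ((3 ^ (n + 1) : ℕ) : ℝ) =
        (3 ^ n * x - ⌊3 ^ n * x⌋ - 1 / 3) * (1 / 3 ^ n) := by
      push_cast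
      rw [pow_succ]
      field_simp
      ring
    rw [h3, abs_mul, abs_of_pos (a := (1 : ℝ) / 3 ^ n) (by positivity)]
    refine mul_le_of_le_one_left (by positivity) (abs_le.2 ⟨by linarith, by linarith⟩)

/-- For each N the condition is a union of open intervals, and it is dense because fractions with
large denominator 3^(n+1) approximate themselves with error 0. -/
theorem eventually_residual_isCubicOddApprox :
    ∀ᶠ α in residual ℝ, ∀ N : ℕ, ∃ q ≥ N, ∃ p, IsCubicOddApprox α p q := by
  refine eventually_countable_forall.2 fun N => ?_
  refine residual_of_dense_open ?_ ?_
  · have : {α : ℝ | ∃ q ≥ N, ∃ p, IsCubicOddApprox α p q} =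
        ⋃ (q : ℕ) (_ : q ≥ N) (p : ℤ) (_ : Odd q) (_ : IsCoprime p (q : ℤ)),
          {α : ℝ | |α - p / q| < 1 / (8 * (q : ℝ) ^ 3)} := by
      ext α
      simp only [IsCubicOddApprox, mem_ofPred_eq, mem_iUnion, exists_prop]
    rw [this]
    refine isOpen_iUnion fun q => isOpen_iUnion fun _ => isOpen_iUnion fun p =>
      isOpen_iUnion fun _ => isOpen_iUnion fun _ => ?_
    exact isOpen_lt (by fun_prop) continuous_const
  · refine Metric.dense_iff.2 fun x ε hε => ?_
    obtain ⟨k, hk⟩ := exists_pow_lt_of_lt_one hε (by norm_num : (1 / 3 : ℝ) < 1)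
    set n := max k N
    obtain ⟨p, hp, hx⟩ := exists_coprime_three_pow_near x n
    refine ⟨p / ((3 ^ (n + 1) : ℕ) : ℝ), ?_, 3 ^ (n + 1), ?_, p, ?_, hp, ?_⟩
    · rw [Metric.mem_ball, Real.dist_eq, abs_sub_comm]
      refine hx.trans_lt (lt_of_le_of_lt ?_ hk)
      rw [← one_div_pow]
      exact pow_le_pow_of_le_one (by norm_num) (by norm_num) (le_max_left _ _)
    · exact (le_max_right k N).trans ((Nat.lt_pow_self (by norm_num)).le.trans
        (Nat.pow_le_pow_right (by norm_num) (Nat.le_succ n)))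
    · exact Odd.pow (by decide)
    · rw [sub_self, abs_zero]
      positivity

/-- A countable set has residual complement; intersected with `s` this would be dense, yet miss
(0,1). -/
theorem not_countable_inter_Ioo_of_mem_residual {s : Set ℝ} (hs : s ∈ residual ℝ) :
    ¬ (s ∩ Ioo 0 1).Countable := by
  intro hc
  have hcompl : (s ∩ Ioo 0 1)ᶜ ∈ residual ℝ := by
    rw [← biUnion_of_singleton (s ∩ Ioo (0 : ℝ) 1), compl_iUnion₂]
    exact (countable_bInter_mem hc).2 fun x _ =>
      residual_of_dense_open isOpen_compl_singleton (dense_compl_singleton x)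
  obtain ⟨x, hx, hxs, hxc⟩ := (dense_of_mem_residual (inter_mem hs hcompl)).inter_open_nonempty
    (Ioo 0 1) isOpen_Ioo (nonempty_Ioo.2 one_pos)
  exact hxc ⟨hxs, hx⟩

end Staircase

theorem mainTheorem5 (l : ℝ) (hl0 : 0 < l) (hl1 : l < 1 / 2) :
    ∃ A : Set ℝ, ¬ A.Countable ∧
      ∀ α ∈ A, α ∈ Set.Ioo (0 : ℝ) 1 ∧ Irrational α ∧
        Ergodic (Staircase.infiniteStaircase α)
          ((volume : Measure UnitAddCircle).prod (Measure.count : Measure ℤ)) ∧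
        (l : EReal) ≤ Staircase.staircaseLyapunovExponent α ∧
        Staircase.staircaseLyapunovExponent α ≠ 0 := by
  refine ⟨_, Staircase.not_countable_inter_Ioo_of_mem_residual
    (eventually_residual_irrational.and Staircase.eventually_residual_isCubicOddApprox), ?_⟩
  rintro α ⟨⟨hirr, happrox⟩, hα⟩
  have hl : (l : EReal) ≤ Staircase.staircaseLyapunovExponent α :=
    (EReal.coe_le_coe_iff.2 hl1.le).trans (Staircase.half_le_staircaseLyapunovExponent happrox)
  exact ⟨hα, hirr, Staircase.ergodic_infiniteStaircase hirr happrox, hl,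
    ((EReal.coe_pos.2 hl0).trans_le hl).ne'⟩
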